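/- **Conventions.** For $p\in(0,1)$ let $E_p(\phi)=\int_0^\phi\sqrt{1-p^2\sin^2\varphi}\,d\varphi$ and $F_p(\phi)=\int_0^\phi\frac{d\varphi}{\sqrt{1-p^2\sin^2\varphi}}$ be the incomplete elliptic integrals of the second and first kind, let $\operatorname{am}_p=F_p^{-1}:\mathbb R\to\mathbb R$ be the Jacobi amplitude, and put $\operatorname{sn}_p=\sin\circ\operatorname{am}_p$, $\operatorname{cn}_p=\cos\circ\operatorname{am}_p$, $\operatorname{dn}_p=\sqrt{1-p^2\operatorname{sn}_p^2}$. For functions $r,h$ write $$x_{r,h}(s,\vartheta)=(r(s)\cos\vartheta,\;r(s)\sin\vartheta,\;h(s)).$$ Let $n\in\{2,3,\dots,\infty\}$. A surface of revolution of class $C^n$ is a map $X:I\times\mathbb R\to\mathbb R^3$, $I$ a nonempty open interval, of the form $X=A\circ x_{\rho,\eta}$ with a Euclidean isometry $A$ and a regular $C^n$ profile curve $(\rho,\eta):I\to(0,\infty)\times\mathbb R$. **Theorem.** Let $X:I\times\mathbb R\to\mathbb R^3$ be a surface of revolution of class $C^n$ with constant Gauss curvature $K\neq0$. Then, up to reparametrization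 of the profile curve, $X$ is homothetic to (an open part of) one of the surfaces $x_{r,h}$ listed below, from the $K=+1$ version if $K>0$ and from the $K=-1$ version if $K<0$. That is, there are a Euclidean isometry $A$ and an injective $C^n$ function $\varphi:I\to\mathbb R$ with nowhere vanishing derivative such that $$X(u,\vartheta)=A\Big(\tfrac{1}{\sqrt{|K|}}\,x_{r,h}(\varphi(u),\vartheta)\Big)\qquad(u\in I,\ \vartheta\in\mathbb R).$$ The profile curves are, with $p\in(0,1)$ in the first and third family: 1. $r(s)=p\operatorname{cn}_p(s)$, with $h(s)=(E_p\circ\operatorname{am}_p)(s)$ for $K=+1$ and $h(s)=(E_p\circ\operatorname{am}_p)(s)-s$ for $K=-1$; 2. $r(s)=\frac1{\cosh s}$, with $h(s)=\tanh s$ for $K=+1$ (sphere) and $h(s)=\tanh s-s$ for $K=-1$ (pseudosphere); 3. $r(s)=\frac1p\operatorname{dn}_p(\frac sp)$, with $h(s)=\frac1p(E_p\circ\operatorname{am}_p)(\frac sp)-\frac{1-p^2}{p^2}s$ for $K=+1$ and $h(s)=\frac1p(E_p\circ\operatorname{am}_p)(\frac sp)-\frac1{p^2}s$ for $K=-1$.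 Moreover, each listed surface $x_{r,h}$ has Gauss curvature $+1$, respectively $-1$, as labelled, at every point where it is immersed. -/

import Mathlib

open MeasureTheory

noncomputable section

/-- Euclidean `3`-space. -/
abbrev E3 : Type := EuclideanSpace ℝ (Fin 3)

/-! ### Elliptic integrals and Jacobi elliptic functions (modulus `p`) -/

/-- The incomplete elliptic integral of the first kind. -/
def ellipticF (p φ : ℝ) : ℝ :=
  ∫ t in (0 : ℝ)..φ, 1 / Real.sqrt (1 - p ^ 2 * Real.sin t ^ 2)

/-- The incomplete elliptic integral of the second kind. -/
def ellipticE (p φ : ℝ) : ℝ :=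
  ∫ t in (0 : ℝ)..φ, Real.sqrt (1 - p ^ 2 * Real.sin t ^ 2)

/-- The Jacobi amplitude, the inverse function of `ellipticF p`
(a bijection of `ℝ` for `0 < p < 1`, see `ellipticF_bijective`). -/
def jacobiAm (p : ℝ) : ℝ → ℝ := Function.invFun (ellipticF p)

def jacobiSn (p s : ℝ) : ℝ := Real.sin (jacobiAm p s)

def jacobiCn (p s : ℝ) : ℝ := Real.cos (jacobiAm p s)

def jacobiDn (p s : ℝ) : ℝ := Real.sqrt (1 - p ^ 2 * jacobiSn p s ^ 2)

theorem ellipticF_bijective {p : ℝ} (hp0 : 0 < p) (hp1 : p < 1) :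
    Function.Bijective (ellipticF p) := by
  have hpos : ∀ t : ℝ, 0 < 1 - p ^ 2 * Real.sin t ^ 2 := fun t => by
    nlinarith [Real.sin_sq_le_one t, sq_nonneg (Real.sin t)]
  have hcont : Continuous fun t : ℝ => 1 / Real.sqrt (1 - p ^ 2 * Real.sin t ^ 2) :=
    continuous_const.div (by fun_prop) fun t => (Real.sqrt_pos.2 (hpos t)).ne'
  have hint : ∀ a b : ℝ, IntervalIntegrable
      (fun t : ℝ => 1 / Real.sqrt (1 - p ^ 2 * Real.sin t ^ 2)) volume a b :=
    fun a b => hcont.intervalIntegrable a b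
  have hone : ∀ t : ℝ, 1 ≤ 1 / Real.sqrt (1 - p ^ 2 * Real.sin t ^ 2) := fun t => by
    rw [le_div_iff₀ (Real.sqrt_pos.2 (hpos t)), one_mul]
    exact Real.sqrt_le_one.2 (by nlinarith [mul_nonneg (sq_nonneg p) (sq_nonneg (Real.sin t))])
  have hgrow : ∀ a b : ℝ, a ≤ b → b - a ≤ ellipticF p b - ellipticF p a := fun a b hab => by
    have h1 : ellipticF p b - ellipticF p a
        = ∫ t in a..b, 1 / Real.sqrt (1 - p ^ 2 * Real.sin t ^ 2) :=
      intervalIntegral.integral_interval_sub_left (hint 0 b) (hint 0 a)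
    have h2 : ∫ _t in a..b, (1 : ℝ) ≤ ∫ t in a..b, 1 / Real.sqrt (1 - p ^ 2 * Real.sin t ^ 2) :=
      intervalIntegral.integral_mono_on hab (by simp) (hint a b) fun t _ => hone t
    rw [h1]
    simpa using h2
  have h0 : ellipticF p 0 = 0 := by simp [ellipticF]
  refine ⟨StrictMono.injective fun a b hab => by linarith [hgrow a b hab.le], ?_⟩
  have hc : Continuous (ellipticF p) :=
    intervalIntegral.continuous_primitive hint 0
  refine hc.surjective ?_ ?_
  · refine Filter.tendsto_atTop_mono' _ ?_ Filter.tendsto_id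
    filter_upwards [Filter.eventually_ge_atTop 0] with x hx
    have := hgrow 0 x hx
    simp only [id]
    linarith
  · refine Filter.tendsto_atBot_mono' _ ?_ Filter.tendsto_id
    filter_upwards [Filter.eventually_le_atBot 0] with x hx
    have := hgrow x 0 hx
    simp only [id]
    linarith

/-! ### Gauss curvature of a parametrized surface -/

/-- Partial derivative in the first parameter. -/
def partialU (X : ℝ → ℝ → E3) (u v : ℝ) : E3 := deriv (fun t => X t v) u

/-- Partial derivative in the second parameter. -/
def partialV (X : ℝ → ℝ → E3) (u v : ℝ) : E3 := deriv (fun t => X u t) v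

/-- The cross product of Euclidean `3`-space. -/
def cross (a b : E3) : E3 := WithLp.toLp 2 (crossProduct (WithLp.ofLp a) (WithLp.ofLp b))

/-- The parametrized surface `X` is immersed at `(u, v)`. -/
def IsImmersedAt (X : ℝ → ℝ → E3) (u v : ℝ) : Prop :=
  LinearIndependent ℝ ![partialU X u v, partialV X u v]

/-- The unit normal (Gauss map). -/
def unitNormal (X : ℝ → ℝ → E3) (u v : ℝ) : E3 :=
  ‖cross (partialU X u v) (partialV X u v)‖⁻¹ • cross (partialU X u v) (partialV X u v)

/-- The Gauss curvature, as the quotient of the determinants of the second and the first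
fundamental form; meaningful where `X` is twice differentiable and immersed. -/
def gaussCurvature (X : ℝ → ℝ → E3) (u v : ℝ) : ℝ :=
  (inner ℝ (partialU (partialU X) u v) (unitNormal X u v)
      * inner ℝ (partialV (partialV X) u v) (unitNormal X u v)
    - inner ℝ (partialV (partialU X) u v) (unitNormal X u v) ^ 2)
  / (inner ℝ (partialU X u v) (partialU X u v) * inner ℝ (partialV X u v) (partialV X u v)
    - inner ℝ (partialU X u v) (partialV X u v) ^ 2)

/-! ### Surfaces of revolution -/

/-- The surface obtained by rotating the profile curve `(r, h)` about the third axis. -/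
def revolve (r h : ℝ → ℝ) (s θ : ℝ) : E3 :=
  !₂[r s * Real.cos θ, r s * Real.sin θ, h s]

/-- `X`, on the parameter domain `I × ℝ`, is an immersed surface of revolution of class `C^n`
about some axis in space: in suitable Euclidean coordinates it is generated by a regular `C^n`
profile curve that does not meet the axis. -/
def IsSurfaceOfRevolution (n : ℕ∞) (X : ℝ → ℝ → E3) (I : Set ℝ) : Prop :=
  ∃ (A : E3 ≃ᵃⁱ[ℝ] E3) (ρ η : ℝ → ℝ),
    ContDiffOn ℝ n ρ I ∧ ContDiffOn ℝ n η I ∧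
    (∀ u ∈ I, 0 < ρ u) ∧
    (∀ u ∈ I, deriv ρ u ≠ 0 ∨ deriv η u ≠ 0) ∧
    ∀ u ∈ I, ∀ θ : ℝ, X u θ = A (revolve ρ η u θ)

/-- After a regular `C^n` change `φ` of the profile parameter, `X` is on `I × ℝ` the image of
(an open part of) the surface `Y` under a similarity of Euclidean space with ratio `c`. -/
def IsHomotheticTo (n : ℕ∞) (c : ℝ) (X : ℝ → ℝ → E3) (I : Set ℝ) (Y : ℝ → ℝ → E3) : Prop :=
  ∃ (A : E3 ≃ᵃⁱ[ℝ] E3) (φ : ℝ → ℝ),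
    ContDiffOn ℝ n φ I ∧ (∀ u ∈ I, deriv φ u ≠ 0) ∧ Set.InjOn φ I ∧
    ∀ u ∈ I, ∀ θ : ℝ, X u θ = A (c • Y (φ u) θ)

/-- The three families of profile curves for `K = +1`. -/
def IsSphericalProfile (r h : ℝ → ℝ) : Prop :=
  (∃ p : ℝ, 0 < p ∧ p < 1 ∧
    r = (fun s => p * jacobiCn p s) ∧
    h = (fun s => ellipticE p (jacobiAm p s))) ∨
  (r = (fun s => 1 / Real.cosh s) ∧
    h = (fun s => Real.tanh s)) ∨
  (∃ p : ℝ, 0 < p ∧ p < 1 ∧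
    r = (fun s => 1 / p * jacobiDn p (s / p)) ∧
    h = (fun s => 1 / p * ellipticE p (jacobiAm p (s / p)) - (1 - p ^ 2) / p ^ 2 * s))

/-- The three families of profile curves for `K = -1`. -/
def IsPseudosphericalProfile (r h : ℝ → ℝ) : Prop :=
  (∃ p : ℝ, 0 < p ∧ p < 1 ∧
    r = (fun s => p * jacobiCn p s) ∧
    h = (fun s => ellipticE p (jacobiAm p s) - s)) ∨
  (r = (fun s => 1 / Real.cosh s) ∧
    h = (fun s => Real.tanh s - s)) ∨
  (∃ p : ℝ, 0 < p ∧ p < 1 ∧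
    r = (fun s => 1 / p * jacobiDn p (s / p)) ∧
    h = (fun s => 1 / p * ellipticE p (jacobiAm p (s / p)) - 1 / p ^ 2 * s))

end

/-! Let the profile `(ρ, η)` have speed `v`, and let `w = ρ' / v` be the cosine of its slope angle.
Gauss curvature is invariant under isometries (`gaussCurvature_isometry_comp`) and explicit for a
rotated curve (`gaussCurvature_revolve`). Curvature `K` then becomes the system `ρ' = w v`, `w' = -K
ρ v` (`hasDerivAt_cos_slope`), with first integral `w ^ 2 + K ρ ^ 2 = c`. Since `K ≠ 0` forces `η' ≠
0`, also `w ^ 2 < 1`.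

After scaling by `k = √|K|`, the value of `c` selects the family: compare it with `1` if `K > 0` and
with `0` if `K < 0`. No ODE is solved. Inverse trigonometric or hyperbolic functions and `ellipticF`
give a parameter `φ` such that the scaled radius is `r ∘ φ` and the derivative of `h ∘ φ` is `k η'`
up to sign (`exists_isSphericalProfile_runsAlong`, `exists_isPseudosphericalProfile_runsAlong`).

That sign is constant on the interval, so `h ∘ φ` and `k η` differ by a vertical reflection and
translation, and `φ` inherits the regularity of `η` (`RunsAlong.isHomotheticTo`). Conversely, the
curvature of each listed surface is a polynomial identity in `sn`, `cn`, `dn` or in `tanh`, `1 /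
cosh`. -/

/-! ### Gauss curvature and its invariance under isometries -/

theorem E3.inner_eq (a b : E3) : inner ℝ a b = a 0 * b 0 + a 1 * b 1 + a 2 * b 2 := by
  simp [PiLp.inner_apply, Fin.sum_univ_three]; ring

/-- The right side is the Gram determinant of `(a, d, e)` against `(c, d, e)`. A single triple
product changes sign under reflections; a product of two involves inner products only, so
orientation-reversing isometries need no separate treatment. -/
theorem inner_cross_mul_inner_cross (a c d e : E3) :
    inner ℝ a (cross d e) * inner ℝ c (cross d e) =
      inner ℝ a c * (inner ℝ d d * inner ℝ e e - inner ℝ d e ^ 2)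
      - inner ℝ a d * (inner ℝ d c * inner ℝ e e - inner ℝ d e * inner ℝ e c)
      + inner ℝ a e * (inner ℝ d c * inner ℝ d e - inner ℝ d d * inner ℝ e c) := by
  simp only [E3.inner_eq, cross, crossProduct, LinearMap.mk₂_apply, Matrix.cons_val_zero,
    Matrix.cons_val_one, Matrix.cons_val]
  ring

theorem norm_cross_sq (d e : E3) :
    ‖cross d e‖ ^ 2 = inner ℝ d d * inner ℝ e e - inner ℝ d e ^ 2 := by
  rw [← real_inner_self_eq_norm_sq]
  simp only [E3.inner_eq, cross, crossProduct, LinearMap.mk₂_apply, Matrix.cons_val_zero,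
    Matrix.cons_val_one, Matrix.cons_val]
  ring

/-- The Gauss curvature in terms of triple products. -/
theorem gaussCurvature_eq_triple (X : ℝ → ℝ → E3) (u v : ℝ) :
    gaussCurvature X u v =
      (inner ℝ (partialU (partialU X) u v) (cross (partialU X u v) (partialV X u v))
        * inner ℝ (partialV (partialV X) u v) (cross (partialU X u v) (partialV X u v))
      - inner ℝ (partialV (partialU X) u v) (cross (partialU X u v) (partialV X u v))
        * inner ℝ (partialV (partialU X) u v) (cross (partialU X u v) (partialV X u v)))
      / (inner ℝ (partialU X u v) (partialU X u v) * inner ℝ (partialV X u v) (partialV X u v)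
        - inner ℝ (partialU X u v) (partialV X u v) ^ 2) ^ 2 := by
  simp only [gaussCurvature, unitNormal, real_inner_smul_right]
  rw [← norm_cross_sq]
  field_simp

/-- Gauss curvature depends on the first and second partial derivatives only up to a linear
isometry. -/
theorem gaussCurvature_congr_isometry (L : E3 ≃ₗᵢ[ℝ] E3) {X Y : ℝ → ℝ → E3} {u v : ℝ}
    (hu : partialU X u v = L (partialU Y u v)) (hv : partialV X u v = L (partialV Y u v))
    (huu : partialU (partialU X) u v = L (partialU (partialU Y) u v))
    (huv : partialV (partialU X) u v = L (partialV (partialU Y) u v))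
    (hvv : partialV (partialV X) u v = L (partialV (partialV Y) u v)) :
    gaussCurvature X u v = gaussCurvature Y u v := by
  simp only [gaussCurvature_eq_triple, inner_cross_mul_inner_cross, hu, hv, huu, huv, hvv,
    LinearIsometryEquiv.inner_map_map]

theorem deriv_linearIsometryEquiv_comp (L : E3 ≃ₗᵢ[ℝ] E3) (f : ℝ → E3) (t : ℝ) :
    deriv (fun s => L (f s)) t = L (deriv f t) := by
  have := L.comp_fderiv (f := f) (x := t)
  rw [← fderiv_apply_one_eq_deriv, ← fderiv_apply_one_eq_deriv]
  have h2 : (fun s => L (f s)) = L ∘ f := rfl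
  rw [h2, this]; rfl

theorem deriv_affineIsometryEquiv_comp (A : E3 ≃ᵃⁱ[ℝ] E3) (f : ℝ → E3) (t : ℝ) :
    deriv (fun s => A (f s)) t = A.linearIsometryEquiv (deriv f t) := by
  have h : (fun s => A (f s)) = fun s => A.linearIsometryEquiv (f s) + A 0 := by
    funext s
    have := A.map_vadd 0 (f s)
    simpa using this
  rw [h, deriv_add_const, deriv_linearIsometryEquiv_comp]

theorem gaussCurvature_isometry_comp (A : E3 ≃ᵃⁱ[ℝ] E3) {X Y : ℝ → ℝ → E3} {I : Set ℝ}
    (hI : IsOpen I) (h : ∀ u ∈ I, ∀ θ : ℝ, X u θ = A (Y u θ)) {u : ℝ} (hu : u ∈ I) (θ : ℝ) :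
    gaussCurvature X u θ = gaussCurvature Y u θ := by
  have h1 : ∀ u ∈ I, ∀ θ, partialU X u θ = A.linearIsometryEquiv (partialU Y u θ) := by
    intro u hu θ
    rw [partialU, partialU, ← deriv_affineIsometryEquiv_comp]
    refine Filter.EventuallyEq.deriv_eq ?_
    filter_upwards [hI.mem_nhds hu] with s hs using h s hs θ
  have h2 : ∀ u ∈ I, ∀ θ, partialV X u θ = A.linearIsometryEquiv (partialV Y u θ) := by
    intro u hu θ
    rw [partialV, partialV, ← deriv_affineIsometryEquiv_comp]
    congr 1
    funext s
    exact h u hu s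
  refine gaussCurvature_congr_isometry A.linearIsometryEquiv (h1 u hu θ) (h2 u hu θ) ?_ ?_ ?_
  · rw [partialU, partialU, ← deriv_linearIsometryEquiv_comp]
    refine Filter.EventuallyEq.deriv_eq ?_
    filter_upwards [hI.mem_nhds hu] with s hs using h1 s hs θ
  · rw [partialV, partialV, ← deriv_linearIsometryEquiv_comp]
    congr 1
    funext s
    exact h1 u hu s
  · rw [partialV, partialV, ← deriv_linearIsometryEquiv_comp]
    congr 1
    funext s
    exact h2 u hu s

/-! ### Curvature of a rotated profile curve -/

theorem HasDerivAt.vec3 {f g h : ℝ → ℝ} {f' g' h' t : ℝ} (hf : HasDerivAt f f' t)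
    (hg : HasDerivAt g g' t) (hh : HasDerivAt h h' t) :
    HasDerivAt (fun s => (!₂[f s, g s, h s] : E3)) !₂[f', g', h'] t := by
  have h1 : HasDerivAt (fun s => ![f s, g s, h s]) ![f', g', h'] t := by
    rw [hasDerivAt_pi]
    intro i
    fin_cases i <;> simpa
  exact (PiLp.hasFDerivAt_toLp (𝕜 := ℝ) 2 _).comp_hasDerivAt t h1

theorem partialU_revolve {r h : ℝ → ℝ} {r' h' s : ℝ} (hr : HasDerivAt r r' s)
    (hh : HasDerivAt h h' s) (θ : ℝ) :
    partialU (revolve r h) s θ = !₂[r' * Real.cos θ, r' * Real.sin θ, h'] :=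
  (HasDerivAt.vec3 (hr.mul_const _) (hr.mul_const _) hh).deriv

theorem partialV_revolve (r h : ℝ → ℝ) (s θ : ℝ) :
    partialV (revolve r h) s θ = !₂[-(r s * Real.sin θ), r s * Real.cos θ, 0] := by
  have := HasDerivAt.vec3 ((Real.hasDerivAt_cos θ).const_mul (r s))
    ((Real.hasDerivAt_sin θ).const_mul (r s)) (hasDerivAt_const θ (h s))
  simpa [partialV, revolve] using this.deriv

/-- Both fundamental forms are diagonal in `(s, θ)`, the unnormalized normal being `r (-h' cos θ,
-h' sin θ, r')`. The profile need not have unit speed. -/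
theorem gaussCurvature_revolve {r h r1 h1 : ℝ → ℝ} {r2 h2 s : ℝ} {I : Set ℝ} (hI : IsOpen I)
    (hr : ∀ t ∈ I, HasDerivAt r (r1 t) t) (hh : ∀ t ∈ I, HasDerivAt h (h1 t) t) (hs : s ∈ I)
    (hr1 : HasDerivAt r1 r2 s) (hh1 : HasDerivAt h1 h2 s) (θ : ℝ)
    (hrs : r s ≠ 0) (hv : r1 s ^ 2 + h1 s ^ 2 ≠ 0) :
    gaussCurvature (revolve r h) s θ =
      h1 s * (h2 * r1 s - h1 s * r2) / (r s * (r1 s ^ 2 + h1 s ^ 2) ^ 2) := by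
  have huu : partialU (partialU (revolve r h)) s θ =
      !₂[r2 * Real.cos θ, r2 * Real.sin θ, h2] := by
    have h3 : (fun t => partialU (revolve r h) t θ) =ᶠ[nhds s]
        fun t => !₂[r1 t * Real.cos θ, r1 t * Real.sin θ, h1 t] := by
      filter_upwards [hI.mem_nhds hs] with t ht using partialU_revolve (hr t ht) (hh t ht) θ
    rw [partialU, h3.deriv_eq]
    exact (HasDerivAt.vec3 (hr1.mul_const _) (hr1.mul_const _) hh1).deriv
  have huv : partialV (partialU (revolve r h)) s θ =
      !₂[-(r1 s * Real.sin θ), r1 s * Real.cos θ, 0] := by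
    have h3 : partialU (revolve r h) s = revolve r1 h1 s :=
      funext fun t => partialU_revolve (hr s hs) (hh s hs) t
    rw [partialV, h3]
    exact partialV_revolve r1 h1 s θ
  have hvv : partialV (partialV (revolve r h)) s θ =
      !₂[-(r s * Real.cos θ), -(r s * Real.sin θ), 0] := by
    have h3 : partialV (revolve r h) s = fun t =>
        !₂[-(r s * Real.sin t), r s * Real.cos t, 0] :=
      funext fun t => partialV_revolve r h s t
    rw [partialV, h3]
    have := HasDerivAt.vec3 ((Real.hasDerivAt_sin θ).const_mul (r s)).neg
      ((Real.hasDerivAt_cos θ).const_mul (r s)) (hasDerivAt_const θ (0 : ℝ))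
    simpa using this.deriv
  have key : ∀ x y : ℝ, x ^ 2 + y ^ 2 = 1 → r2 * x * (-(h1 s * (r s * x))) +
      r2 * y * (-(h1 s * (r s * y))) + h2 * (r1 s * r s) =
        r s * (h2 * r1 s - h1 s * r2) := by
    intro x y hxy
    linear_combination (-(r2 * h1 s * r s)) * hxy
  have hc : cross (partialU (revolve r h) s θ) (partialV (revolve r h) s θ) =
      !₂[-(h1 s * (r s * Real.cos θ)), -(h1 s * (r s * Real.sin θ)), r1 s * r s] := by
    rw [partialU_revolve (hr s hs) (hh s hs), partialV_revolve]
    ext i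
    fin_cases i
    · simp [cross, crossProduct]
    · simp [cross, crossProduct]
    · simp [cross, crossProduct]
      linear_combination (r1 s * r s) * Real.sin_sq_add_cos_sq θ
  rw [gaussCurvature_eq_triple, hc, huu, huv, hvv, partialU_revolve (hr s hs) (hh s hs),
    partialV_revolve]
  simp only [E3.inner_eq, Matrix.cons_val_zero, Matrix.cons_val_one, Matrix.cons_val]
  rw [key _ _ (Real.cos_sq_add_sin_sq θ)]
  have e1 : -(r s * Real.cos θ) * -(h1 s * (r s * Real.cos θ)) +
      -(r s * Real.sin θ) * -(h1 s * (r s * Real.sin θ)) + 0 * (r1 s * r s) = h1 s * r s ^ 2 := by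
    linear_combination (h1 s * r s ^ 2) * Real.sin_sq_add_cos_sq θ
  have e2 : -(r1 s * Real.sin θ) * -(h1 s * (r s * Real.cos θ)) +
      r1 s * Real.cos θ * -(h1 s * (r s * Real.sin θ)) + 0 * (r1 s * r s) = 0 := by ring
  have e3 : r1 s * Real.cos θ * (r1 s * Real.cos θ) + r1 s * Real.sin θ * (r1 s * Real.sin θ)
      + h1 s * h1 s = r1 s ^ 2 + h1 s ^ 2 := by
    linear_combination (r1 s ^ 2) * Real.sin_sq_add_cos_sq θ
  have e4 : -(r s * Real.sin θ) * -(r s * Real.sin θ) + r s * Real.cos θ * (r s * Real.cos θ)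
      + 0 * 0 = r s ^ 2 := by
    linear_combination (r s ^ 2) * Real.sin_sq_add_cos_sq θ
  have e5 : r1 s * Real.cos θ * -(r s * Real.sin θ) + r1 s * Real.sin θ * (r s * Real.cos θ)
      + h1 s * 0 = 0 := by ring
  rw [e1, e2, e3, e4, e5]
  field_simp
  ring

theorem IsImmersedAt.revolve_ne_zero {r h : ℝ → ℝ} {r' h' s θ : ℝ}
    (H : IsImmersedAt (revolve r h) s θ) (hr : HasDerivAt r r' s) (hh : HasDerivAt h h' s) :
    r s ≠ 0 ∧ r' ^ 2 + h' ^ 2 ≠ 0 := by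
  constructor
  · intro h0
    refine H.ne_zero 1 ?_
    simp [partialV_revolve, h0]
  · intro h0
    have h1 : r' = 0 := by nlinarith
    have h2 : h' = 0 := by nlinarith
    refine H.ne_zero 0 ?_
    simp [partialU_revolve hr hh, h1, h2]

/-- With the denominator cleared, constant curvature is an identity that makes sense at singular
parameters too; immersion serves only to divide back. -/
theorem gaussCurvature_revolve_of_isImmersedAt {r h r1 h1 r2 h2 : ℝ → ℝ} {K : ℝ}
    (hr : ∀ t, HasDerivAt r (r1 t) t) (hh : ∀ t, HasDerivAt h (h1 t) t)
    (hr1 : ∀ t, HasDerivAt r1 (r2 t) t) (hh1 : ∀ t, HasDerivAt h1 (h2 t) t)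
    (hK : ∀ t, h1 t * (h2 t * r1 t - h1 t * r2 t) = K * (r t * (r1 t ^ 2 + h1 t ^ 2) ^ 2))
    (s θ : ℝ) (H : IsImmersedAt (revolve r h) s θ) :
    gaussCurvature (revolve r h) s θ = K := by
  obtain ⟨h0, hv⟩ := H.revolve_ne_zero (hr s) (hh s)
  rw [gaussCurvature_revolve isOpen_univ (fun t _ => hr t) (fun t _ => hh t) (Set.mem_univ s)
    (hr1 s) (hh1 s) θ h0 hv, hK]
  exact mul_div_cancel_right₀ K (mul_ne_zero h0 (pow_ne_zero 2 hv))

/-! ### Calculus of elliptic integrals and Jacobi functions -/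

theorem one_sub_sq_mul_sin_sq_pos {p : ℝ} (hp0 : 0 < p) (hp1 : p < 1) (t : ℝ) :
    0 < 1 - p ^ 2 * Real.sin t ^ 2 := by
  nlinarith [Real.sin_sq_le_one t, sq_nonneg (Real.sin t)]

theorem contDiff_sqrt_one_sub_sq_mul_sin_sq {p : ℝ} (hp0 : 0 < p) (hp1 : p < 1)
    {n : WithTop ℕ∞} : ContDiff ℝ n fun t => Real.sqrt (1 - p ^ 2 * Real.sin t ^ 2) :=
  (contDiff_const.sub (contDiff_const.mul (Real.contDiff_sin.pow 2))).sqrt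
    fun t => (one_sub_sq_mul_sin_sq_pos hp0 hp1 t).ne'

theorem hasDerivAt_ellipticE {p : ℝ} (hp0 : 0 < p) (hp1 : p < 1) (x : ℝ) :
    HasDerivAt (ellipticE p) (Real.sqrt (1 - p ^ 2 * Real.sin x ^ 2)) x :=
  (contDiff_sqrt_one_sub_sq_mul_sin_sq (n := 0) hp0 hp1).continuous.integral_hasStrictDerivAt
    0 x |>.hasDerivAt

theorem contDiff_one_div_sqrt_one_sub_sq_mul_sin_sq {p : ℝ} (hp0 : 0 < p) (hp1 : p < 1)
    {n : WithTop ℕ∞} : ContDiff ℝ n fun t => 1 / Real.sqrt (1 - p ^ 2 * Real.sin t ^ 2) :=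
  contDiff_const.div (contDiff_sqrt_one_sub_sq_mul_sin_sq hp0 hp1)
    fun t => (Real.sqrt_pos.2 (one_sub_sq_mul_sin_sq_pos hp0 hp1 t)).ne'

theorem hasDerivAt_ellipticF {p : ℝ} (hp0 : 0 < p) (hp1 : p < 1) (x : ℝ) :
    HasDerivAt (ellipticF p) (1 / Real.sqrt (1 - p ^ 2 * Real.sin x ^ 2)) x :=
  (contDiff_one_div_sqrt_one_sub_sq_mul_sin_sq (n := 0) hp0 hp1).continuous.integral_hasStrictDerivAt
    0 x |>.hasDerivAt

theorem contDiff_ellipticE {p : ℝ} (hp0 : 0 < p) (hp1 : p < 1) :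
    ContDiff ℝ (⊤ : ℕ∞) (ellipticE p) := by
  refine contDiff_infty_iff_deriv.2
    ⟨fun x => (hasDerivAt_ellipticE hp0 hp1 x).differentiableAt, ?_⟩
  rw [funext fun x => (hasDerivAt_ellipticE hp0 hp1 x).deriv]
  exact contDiff_sqrt_one_sub_sq_mul_sin_sq hp0 hp1

theorem contDiff_ellipticF {p : ℝ} (hp0 : 0 < p) (hp1 : p < 1) :
    ContDiff ℝ (⊤ : ℕ∞) (ellipticF p) := by
  refine contDiff_infty_iff_deriv.2
    ⟨fun x => (hasDerivAt_ellipticF hp0 hp1 x).differentiableAt, ?_⟩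
  rw [funext fun x => (hasDerivAt_ellipticF hp0 hp1 x).deriv]
  exact contDiff_one_div_sqrt_one_sub_sq_mul_sin_sq hp0 hp1

theorem jacobiAm_ellipticF {p : ℝ} (hp0 : 0 < p) (hp1 : p < 1) (x : ℝ) :
    jacobiAm p (ellipticF p x) = x :=
  Function.leftInverse_invFun (ellipticF_bijective hp0 hp1).injective x

theorem strictMono_ellipticF {p : ℝ} (hp0 : 0 < p) (hp1 : p < 1) : StrictMono (ellipticF p) :=
  strictMono_of_deriv_pos fun x => by
    rw [(hasDerivAt_ellipticF hp0 hp1 x).deriv]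
    exact one_div_pos.2 (Real.sqrt_pos.2 (one_sub_sq_mul_sin_sq_pos hp0 hp1 x))

theorem contDiff_jacobiAm {p : ℝ} (hp0 : 0 < p) (hp1 : p < 1) :
    ContDiff ℝ (⊤ : ℕ∞) (jacobiAm p) := by
  -- A strictly increasing surjection is a homeomorphism, and the inverse of a smooth homeomorphism
  -- with nonvanishing derivative is smooth.
  set e := ((strictMono_ellipticF hp0 hp1).orderIsoOfSurjective _
    (ellipticF_bijective hp0 hp1).surjective).toHomeomorph
  have he : jacobiAm p = e.symm := by
    funext s
    obtain ⟨x, rfl⟩ := (ellipticF_bijective hp0 hp1).surjective s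
    rw [jacobiAm_ellipticF hp0 hp1]
    exact (e.symm_apply_apply x).symm
  rw [he]
  exact e.contDiff_symm_deriv
    (fun x => (one_div_pos.2 (Real.sqrt_pos.2 (one_sub_sq_mul_sin_sq_pos hp0 hp1 x))).ne')
    (hasDerivAt_ellipticF hp0 hp1) (contDiff_ellipticF hp0 hp1)

theorem hasDerivAt_jacobiAm {p : ℝ} (hp0 : 0 < p) (hp1 : p < 1) (s : ℝ) :
    HasDerivAt (jacobiAm p) (jacobiDn p s) s := by
  have := HasDerivAt.of_local_left_inverse (contDiff_jacobiAm hp0 hp1).continuous.continuousAt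
    (hasDerivAt_ellipticF hp0 hp1 (jacobiAm p s))
    (one_div_pos.2 (Real.sqrt_pos.2 (one_sub_sq_mul_sin_sq_pos hp0 hp1 _))).ne'
    (Filter.Eventually.of_forall fun y =>
      Function.rightInverse_invFun (ellipticF_bijective hp0 hp1).surjective y)
  simpa [jacobiDn, jacobiSn] using this

theorem jacobiSn_sq_add_jacobiCn_sq (p s : ℝ) : jacobiSn p s ^ 2 + jacobiCn p s ^ 2 = 1 :=
  Real.sin_sq_add_cos_sq _

theorem jacobiDn_sq {p : ℝ} (hp0 : 0 < p) (hp1 : p < 1) (s : ℝ) :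
    jacobiDn p s ^ 2 = 1 - p ^ 2 * jacobiSn p s ^ 2 :=
  Real.sq_sqrt (one_sub_sq_mul_sin_sq_pos hp0 hp1 _).le

theorem jacobiDn_pos {p : ℝ} (hp0 : 0 < p) (hp1 : p < 1) (s : ℝ) : 0 < jacobiDn p s :=
  Real.sqrt_pos.2 (one_sub_sq_mul_sin_sq_pos hp0 hp1 _)

theorem hasDerivAt_jacobiSn {p : ℝ} (hp0 : 0 < p) (hp1 : p < 1) (s : ℝ) :
    HasDerivAt (jacobiSn p) (jacobiCn p s * jacobiDn p s) s :=
  (hasDerivAt_jacobiAm hp0 hp1 s).sin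

theorem hasDerivAt_jacobiCn {p : ℝ} (hp0 : 0 < p) (hp1 : p < 1) (s : ℝ) :
    HasDerivAt (jacobiCn p) (-jacobiSn p s * jacobiDn p s) s :=
  (hasDerivAt_jacobiAm hp0 hp1 s).cos

theorem hasDerivAt_jacobiDn {p : ℝ} (hp0 : 0 < p) (hp1 : p < 1) (s : ℝ) :
    HasDerivAt (jacobiDn p) (-(p ^ 2 * jacobiSn p s * jacobiCn p s)) s := by
  have h := ((((hasDerivAt_jacobiSn hp0 hp1 s).fun_pow 2).const_mul (p ^ 2)).const_sub 1).sqrt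
    (one_sub_sq_mul_sin_sq_pos hp0 hp1 _).ne'
  have hD := (jacobiDn_pos hp0 hp1 s).ne'
  refine h.congr_deriv ?_
  change _ / (2 * jacobiDn p s) = _
  field_simp
  simp
  ring

theorem hasDerivAt_ellipticE_jacobiAm {p : ℝ} (hp0 : 0 < p) (hp1 : p < 1) (s : ℝ) :
    HasDerivAt (fun s => ellipticE p (jacobiAm p s)) (jacobiDn p s ^ 2) s := by
  have := (hasDerivAt_ellipticE hp0 hp1 _).comp s (hasDerivAt_jacobiAm hp0 hp1 s)
  rw [sq]
  exact this

theorem contDiff_ellipticE_jacobiAm {p : ℝ} (hp0 : 0 < p) (hp1 : p < 1) :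
    ContDiff ℝ (⊤ : ℕ∞) fun s => ellipticE p (jacobiAm p s) :=
  (contDiff_ellipticE hp0 hp1).comp (contDiff_jacobiAm hp0 hp1)

theorem Real.hasDerivAt_tanh_inv_cosh_sq (s : ℝ) :
    HasDerivAt Real.tanh ((1 / Real.cosh s) ^ 2) s := by
  have h := (Real.hasDerivAt_sinh s).div (Real.hasDerivAt_cosh s) (Real.cosh_pos s).ne'
  rw [show Real.tanh = Real.sinh / Real.cosh from funext Real.tanh_eq_sinh_div_cosh]
  refine h.congr_deriv ?_
  rw [one_div, inv_pow, ← one_div]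
  congr 1
  linear_combination Real.cosh_sq s

theorem Real.hasDerivAt_one_div_cosh (s : ℝ) :
    HasDerivAt (fun s => 1 / Real.cosh s) (-(Real.tanh s * (1 / Real.cosh s))) s := by
  have h := (Real.hasDerivAt_cosh s).inv (Real.cosh_pos s).ne'
  simp only [one_div]
  refine h.congr_deriv ?_
  rw [Real.tanh_eq_sinh_div_cosh]
  field_simp

theorem Real.tanh_sq_eq (s : ℝ) : Real.tanh s ^ 2 = 1 - (1 / Real.cosh s) ^ 2 := by
  rw [Real.tanh_eq_sinh_div_cosh]
  have := (Real.cosh_pos s).ne'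
  field_simp
  linear_combination -Real.cosh_sq s

theorem Real.contDiff_tanh_infty : ContDiff ℝ (⊤ : ℕ∞) Real.tanh := by
  rw [show Real.tanh = fun s => Real.sinh s / Real.cosh s from funext Real.tanh_eq_sinh_div_cosh]
  exact Real.contDiff_sinh.div Real.contDiff_cosh fun s => (Real.cosh_pos s).ne'

/-! ### Curvature of the listed surfaces -/

/-- A vertical drift `c` in the profile `(p cn, E ∘ am - c s)`. -/
theorem gaussCurvature_revolve_cn {p K c : ℝ} (hp0 : 0 < p) (hp1 : p < 1)
    (hc : (K = 1 ∧ c = 0) ∨ (K = -1 ∧ c = 1)) (s θ : ℝ)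
    (H : IsImmersedAt (revolve (fun s => p * jacobiCn p s)
      (fun s => ellipticE p (jacobiAm p s) - c * s)) s θ) :
    gaussCurvature (revolve (fun s => p * jacobiCn p s)
      (fun s => ellipticE p (jacobiAm p s) - c * s)) s θ = K := by
  refine gaussCurvature_revolve_of_isImmersedAt
    (fun t => (hasDerivAt_jacobiCn hp0 hp1 t).const_mul p)
    (fun t => (hasDerivAt_ellipticE_jacobiAm hp0 hp1 t).sub ((hasDerivAt_id' t).const_mul c))
    (fun t => (((hasDerivAt_jacobiSn hp0 hp1 t).neg.mul
      (hasDerivAt_jacobiDn hp0 hp1 t)).const_mul p))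
    (fun t => ((hasDerivAt_jacobiDn hp0 hp1 t).fun_pow 2).sub_const (c * 1)) (fun t => ?_) s θ H
  have h1 := jacobiSn_sq_add_jacobiCn_sq p t
  have h2 := jacobiDn_sq hp0 hp1 t
  simp only [Pi.neg_apply]
  generalize jacobiSn p t = S at *
  generalize jacobiCn p t = C at *
  generalize jacobiDn p t = D at *
  rcases hc with ⟨rfl, rfl⟩ | ⟨rfl, rfl⟩ <;> norm_num <;> grind

/-- At argument `s / p` the velocity is `cn (-sn, cn)` for `K = 1` and `-sn (cn, sn)` for `K = -1`;
the drift `c` is what brings `h'` to `cn ^ 2` or `-sn ^ 2`. -/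
theorem gaussCurvature_revolve_dn {p K c : ℝ} (hp0 : 0 < p) (hp1 : p < 1)
    (hc : (K = 1 ∧ c = (1 - p ^ 2) / p ^ 2) ∨ (K = -1 ∧ c = 1 / p ^ 2)) (s θ : ℝ)
    (H : IsImmersedAt (revolve (fun s => 1 / p * jacobiDn p (s / p))
      (fun s => 1 / p * ellipticE p (jacobiAm p (s / p)) - c * s)) s θ) :
    gaussCurvature (revolve (fun s => 1 / p * jacobiDn p (s / p))
      (fun s => 1 / p * ellipticE p (jacobiAm p (s / p)) - c * s)) s θ = K := by
  have hd : ∀ t, HasDerivAt (fun t => t / p) (1 / p) t := fun t => (hasDerivAt_id' t).div_const p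
  have hS : ∀ t, HasDerivAt (fun s => jacobiSn p (s / p)) _ t := fun t =>
    HasDerivAt.comp (h₂ := jacobiSn p) t (hasDerivAt_jacobiSn hp0 hp1 (t / p)) (hd t)
  have hC : ∀ t, HasDerivAt (fun s => jacobiCn p (s / p)) _ t := fun t =>
    HasDerivAt.comp (h₂ := jacobiCn p) t (hasDerivAt_jacobiCn hp0 hp1 (t / p)) (hd t)
  have hD : ∀ t, HasDerivAt (fun s => jacobiDn p (s / p)) _ t := fun t =>
    HasDerivAt.comp (h₂ := jacobiDn p) t (hasDerivAt_jacobiDn hp0 hp1 (t / p)) (hd t)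
  have hE : ∀ t, HasDerivAt (fun s => ellipticE p (jacobiAm p (s / p))) _ t := fun t =>
    HasDerivAt.comp (h₂ := fun s => ellipticE p (jacobiAm p s)) t
      (hasDerivAt_ellipticE_jacobiAm hp0 hp1 (t / p)) (hd t)
  have hr : ∀ t, HasDerivAt (fun s => 1 / p * jacobiDn p (s / p))
      (-(jacobiSn p (t / p) * jacobiCn p (t / p))) t := fun t =>
    ((hD t).const_mul (1 / p)).congr_deriv (by field_simp)
  have hh : ∀ t, HasDerivAt (fun s => 1 / p * ellipticE p (jacobiAm p (s / p)) - c * s)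
      (1 / p ^ 2 - c - jacobiSn p (t / p) ^ 2) t := fun t => by
    refine (((hE t).const_mul (1 / p)).sub ((hasDerivAt_id' t).const_mul c)).congr_deriv ?_
    rw [jacobiDn_sq hp0 hp1]
    field_simp
    ring
  refine gaussCurvature_revolve_of_isImmersedAt hr hh (fun t => ((hS t).mul (hC t)).neg)
    (fun t => ((hS t).fun_pow 2).const_sub _) (fun t => ?_) s θ H
  have h1 := jacobiSn_sq_add_jacobiCn_sq p (t / p)
  have h2 := jacobiDn_sq hp0 hp1 (t / p)
  generalize jacobiSn p (t / p) = S at *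
  generalize jacobiCn p (t / p) = C at *
  generalize jacobiDn p (t / p) = D at *
  have hC2 : C ^ 2 = 1 - S ^ 2 := by linarith
  rcases hc with ⟨rfl, rfl⟩ | ⟨rfl, rfl⟩
  · have e : 1 / p ^ 2 - (1 - p ^ 2) / p ^ 2 - S ^ 2 = C ^ 2 := by
      field_simp; linear_combination p ^ 2 * h1.symm
    rw [e]
    field_simp
    norm_num
    grind
  · rw [sub_self, zero_sub]
    field_simp
    norm_num
    grind

theorem gaussCurvature_revolve_sech {K c : ℝ}
    (hc : (K = 1 ∧ c = 0) ∨ (K = -1 ∧ c = 1)) (s θ : ℝ)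
    (H : IsImmersedAt (revolve (fun s => 1 / Real.cosh s) (fun s => Real.tanh s - c * s)) s θ) :
    gaussCurvature (revolve (fun s => 1 / Real.cosh s) (fun s => Real.tanh s - c * s)) s θ
      = K := by
  refine gaussCurvature_revolve_of_isImmersedAt Real.hasDerivAt_one_div_cosh
    (fun t => (Real.hasDerivAt_tanh_inv_cosh_sq t).sub ((hasDerivAt_id' t).const_mul c))
    (fun t => ((Real.hasDerivAt_tanh_inv_cosh_sq t).mul (Real.hasDerivAt_one_div_cosh t)).neg)
    (fun t => ((Real.hasDerivAt_one_div_cosh t).fun_pow 2).sub_const (c * 1)) (fun t => ?_) s θ H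
  have h1 := Real.tanh_sq_eq t
  generalize Real.tanh t = T at *
  generalize 1 / Real.cosh t = S at *
  rcases hc with ⟨rfl, rfl⟩ | ⟨rfl, rfl⟩ <;> norm_num <;> grind

theorem IsSphericalProfile.gaussCurvature_eq {r h : ℝ → ℝ} (H : IsSphericalProfile r h)
    (s θ : ℝ) (hi : IsImmersedAt (revolve r h) s θ) :
    gaussCurvature (revolve r h) s θ = 1 := by
  rcases H with ⟨p, hp0, hp1, rfl, rfl⟩ | ⟨rfl, rfl⟩ | ⟨p, hp0, hp1, rfl, rfl⟩
  · simpa using gaussCurvature_revolve_cn (K := 1) (c := 0) hp0 hp1 (by simp) s θ (by simpa)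
  · simpa using gaussCurvature_revolve_sech (K := 1) (c := 0) (by simp) s θ (by simpa using hi)
  · exact gaussCurvature_revolve_dn hp0 hp1 (Or.inl ⟨rfl, rfl⟩) s θ hi

theorem IsPseudosphericalProfile.gaussCurvature_eq {r h : ℝ → ℝ}
    (H : IsPseudosphericalProfile r h) (s θ : ℝ) (hi : IsImmersedAt (revolve r h) s θ) :
    gaussCurvature (revolve r h) s θ = -1 := by
  rcases H with ⟨p, hp0, hp1, rfl, rfl⟩ | ⟨rfl, rfl⟩ | ⟨p, hp0, hp1, rfl, rfl⟩
  · simpa using gaussCurvature_revolve_cn (K := -1) (c := 1) hp0 hp1 (by simp) s θ (by simpa)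
  · simpa using gaussCurvature_revolve_sech (K := -1) (c := 1) (by simp) s θ (by simpa using hi)
  · exact gaussCurvature_revolve_dn hp0 hp1 (Or.inr ⟨rfl, rfl⟩) s θ hi

/-! ### Explicit parameters along the model profiles -/

theorem Real.hasDerivAt_arcsin_of_sq_add_sq {x y : ℝ} (h : x ^ 2 + y ^ 2 = 1) (hy : 0 < y) :
    HasDerivAt Real.arcsin (1 / y) x := by
  have e : Real.sqrt (1 - x ^ 2) = y := by
    rw [show 1 - x ^ 2 = y ^ 2 by linarith, Real.sqrt_sq hy.le]
  rw [← e]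
  exact Real.hasDerivAt_arcsin (by rintro rfl; nlinarith) (by rintro rfl; nlinarith)

theorem Real.sin_arcsin_of_sq_add_sq {x y : ℝ} (h : x ^ 2 + y ^ 2 = 1) :
    Real.sin (Real.arcsin x) = x :=
  Real.sin_arcsin (by nlinarith) (by nlinarith)

theorem Real.cos_arcsin_of_sq_add_sq {x y : ℝ} (h : x ^ 2 + y ^ 2 = 1) (hy : 0 < y) :
    Real.cos (Real.arcsin x) = y := by
  rw [Real.cos_arcsin, show 1 - x ^ 2 = y ^ 2 by linarith, Real.sqrt_sq hy.le]

theorem Real.hasDerivAt_arccos_of_sq_add_sq {x y : ℝ} (h : x ^ 2 + y ^ 2 = 1) (hy : 0 < y) :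
    HasDerivAt Real.arccos (-(1 / y)) x :=
  (Real.hasDerivAt_arcsin_of_sq_add_sq h hy).const_sub _

theorem Real.cos_arccos_of_sq_add_sq {x y : ℝ} (h : x ^ 2 + y ^ 2 = 1) :
    Real.cos (Real.arccos x) = x :=
  Real.cos_arccos (by nlinarith) (by nlinarith)

theorem Real.sin_arccos_of_sq_add_sq {x y : ℝ} (h : x ^ 2 + y ^ 2 = 1) (hy : 0 < y) :
    Real.sin (Real.arccos x) = y := by
  rw [Real.sin_arccos, show 1 - x ^ 2 = y ^ 2 by linarith, Real.sqrt_sq hy.le]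

theorem jacobiDn_ellipticF {p x d : ℝ} (hp0 : 0 < p) (hp1 : p < 1) (hd : 0 < d)
    (h : d ^ 2 = 1 - p ^ 2 * Real.sin x ^ 2) : jacobiDn p (ellipticF p x) = d := by
  rw [jacobiDn, jacobiSn, jacobiAm_ellipticF hp0 hp1, ← h, Real.sqrt_sq hd.le]

theorem hasDerivAt_ellipticF_comp {p u a d : ℝ} {α : ℝ → ℝ} (hp0 : 0 < p) (hp1 : p < 1)
    (hd : 0 < d) (h : d ^ 2 = 1 - p ^ 2 * Real.sin (α u) ^ 2) (hα : HasDerivAt α a u) :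
    HasDerivAt (fun t => ellipticF p (α t)) (1 / d * a) u := by
  have := (hasDerivAt_ellipticF hp0 hp1 (α u)).comp u hα
  rwa [← h, Real.sqrt_sq hd.le] at this

theorem hasDerivAt_ellipticE_jacobiAm_div {p : ℝ} (hp0 : 0 < p) (hp1 : p < 1) (k s : ℝ) :
    HasDerivAt (fun s => 1 / p * ellipticE p (jacobiAm p (s / p)) - k * s)
      (1 / p ^ 2 * jacobiDn p (s / p) ^ 2 - k) s := by
  have h := HasDerivAt.comp (h₂ := fun s => ellipticE p (jacobiAm p s)) s
    (hasDerivAt_ellipticE_jacobiAm hp0 hp1 (s / p)) ((hasDerivAt_id' s).div_const p)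
  refine ((h.const_mul (1 / p)).sub ((hasDerivAt_id' s).const_mul k)).congr_deriv ?_
  field_simp

theorem contDiff_ellipticE_jacobiAm_div {p : ℝ} (hp0 : 0 < p) (hp1 : p < 1) (k : ℝ) :
    ContDiff ℝ (⊤ : ℕ∞) fun s => 1 / p * ellipticE p (jacobiAm p (s / p)) - k * s :=
  (contDiff_const.mul ((contDiff_ellipticE_jacobiAm hp0 hp1).comp
    (contDiff_id.div_const p))).sub (contDiff_const.mul contDiff_id)

/-- The profile with radius `R`, speed `V` and cosine `w` of the slope angle runs, up to the sign
of the height velocity, along the curve `(r, h)`. -/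
def RunsAlong (I : Set ℝ) (R w V r h : ℝ → ℝ) : Prop :=
  ContDiff ℝ (⊤ : ℕ∞) h ∧ ∃ φ : ℝ → ℝ, ∀ u ∈ I, ∃ d : ℝ, HasDerivAt φ d u ∧ R u = r (φ u) ∧
    (deriv h (φ u) * d) ^ 2 = (1 - w u ^ 2) * V u ^ 2

/-- The first integral of the model curves is `p ^ 2`, `1` and `1 / p ^ 2` respectively, which fixes
the family and the modulus. Reading off `R` and `w` on the model then determines `φ`. -/
theorem exists_isSphericalProfile_runsAlong {I : Set ℝ} {R w V : ℝ → ℝ} {c : ℝ}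
    (hR : ∀ u ∈ I, 0 < R u) (hw : ∀ u ∈ I, w u ^ 2 < 1)
    (hw' : ∀ u ∈ I, HasDerivAt w (-(R u * V u)) u)
    (hR' : ∀ u ∈ I, HasDerivAt R (w u * V u) u)
    (hc : ∀ u ∈ I, w u ^ 2 + R u ^ 2 = c) (hc0 : 0 < c) :
    ∃ r h, IsSphericalProfile r h ∧ RunsAlong I R w V r h := by
  rcases lt_trichotomy c 1 with hc1 | rfl | hc1
  · obtain ⟨p, hp0, hpc⟩ : ∃ p : ℝ, 0 < p ∧ p ^ 2 = c :=
      ⟨Real.sqrt c, Real.sqrt_pos.2 hc0, Real.sq_sqrt hc0.le⟩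
    have hp1 : p < 1 := by nlinarith
    -- On this model `w = -p sn` and `R = p cn`, so the amplitude is `arcsin (-w / p)`.
    refine ⟨_, _, Or.inl ⟨p, hp0, hp1, rfl, rfl⟩, contDiff_ellipticE_jacobiAm hp0 hp1,
      fun t => ellipticF p (Real.arcsin (-w t / p)), fun u hu => ?_⟩
    have hRu := hR u hu
    have hxy : (-w u / p) ^ 2 + (R u / p) ^ 2 = 1 := by
      field_simp
      linear_combination hc u hu - hpc
    have hy : 0 < R u / p := by positivity
    obtain ⟨d, hd0, hd⟩ : ∃ d : ℝ, 0 < d ∧ d ^ 2 = 1 - w u ^ 2 :=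
      ⟨Real.sqrt (1 - w u ^ 2), Real.sqrt_pos.2 (by linarith [hw u hu]),
        Real.sq_sqrt (by linarith [hw u hu])⟩
    have hd' : d ^ 2 = 1 - p ^ 2 * Real.sin (Real.arcsin (-w u / p)) ^ 2 := by
      rw [Real.sin_arcsin_of_sq_add_sq hxy, hd]
      field_simp
    have hα : HasDerivAt (fun t => Real.arcsin (-w t / p)) _ u :=
      (Real.hasDerivAt_arcsin_of_sq_add_sq hxy hy).comp (h := fun t => -w t / p) u
        ((hw' u hu).neg.div_const p)
    refine ⟨_, hasDerivAt_ellipticF_comp hp0 hp1 hd0 hd' hα, ?_, ?_⟩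
    · beta_reduce
      rw [jacobiCn, jacobiAm_ellipticF hp0 hp1, Real.cos_arcsin_of_sq_add_sq hxy hy]
      field_simp
    · rw [(hasDerivAt_ellipticE_jacobiAm hp0 hp1 _).deriv, jacobiDn_ellipticF hp0 hp1 hd0 hd', ← hd]
      field_simp
  -- Here `w = -tanh φ` and `R = 1 / cosh φ`, hence `sinh φ = -w / R`.
  · refine ⟨_, _, Or.inr (Or.inl ⟨rfl, rfl⟩), Real.contDiff_tanh_infty,
      fun t => Real.arsinh (-w t / R t), fun u hu => ?_⟩
    have hRu := hR u hu
    have hs : Real.sqrt (1 + (-w u / R u) ^ 2) = 1 / R u := by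
      rw [← Real.sqrt_sq (one_div_pos.2 hRu).le]
      congr 1
      field_simp
      linear_combination hc u hu
    have hα : HasDerivAt (fun t => Real.arsinh (-w t / R t)) _ u :=
      (Real.hasDerivAt_arsinh _).comp (h := fun t => -w t / R t) u
        ((hw' u hu).neg.div (hR' u hu) hRu.ne')
    refine ⟨_, hα, ?_, ?_⟩
    · beta_reduce
      rw [Real.cosh_arsinh, hs, one_div_one_div]
    · rw [(Real.hasDerivAt_tanh_inv_cosh_sq _).deriv, Real.cosh_arsinh, hs]
      have h1 : 1 - w u ^ 2 = R u ^ 2 := by linear_combination -hc u hu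
      rw [h1]
      have h2 : - -(R u * V u) * R u - -w u * (w u * V u) = V u := by
        linear_combination V u * hc u hu
      simp only [Pi.neg_apply]
      rw [h2]
      field_simp
  · obtain ⟨p, hp0, hpc⟩ : ∃ p : ℝ, 0 < p ∧ p ^ 2 * c = 1 :=
      ⟨Real.sqrt (1 / c), Real.sqrt_pos.2 (by positivity), by
        rw [Real.sq_sqrt (by positivity)]; field_simp⟩
    have hp1 : p < 1 := by
      by_contra! hp
      nlinarith [mul_le_mul hp hp zero_le_one hp0.le]
    -- On the arc with `cn > 0` the model has `w = -sn`, and the first integral gives `dn = p R`.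
    refine ⟨_, _, Or.inr (Or.inr ⟨p, hp0, hp1, rfl, rfl⟩),
      contDiff_ellipticE_jacobiAm_div hp0 hp1 _,
      fun t => p * ellipticF p (Real.arcsin (-w t)), fun u hu => ?_⟩
    have hRu := hR u hu
    obtain ⟨y, hy0, hy⟩ : ∃ y : ℝ, 0 < y ∧ y ^ 2 = 1 - w u ^ 2 :=
      ⟨Real.sqrt (1 - w u ^ 2), Real.sqrt_pos.2 (by linarith [hw u hu]),
        Real.sq_sqrt (by linarith [hw u hu])⟩
    have hxy : (-w u) ^ 2 + y ^ 2 = 1 := by rw [hy]; ring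
    have hd0 : 0 < p * R u := by positivity
    have hd' : (p * R u) ^ 2 = 1 - p ^ 2 * Real.sin (Real.arcsin (-w u)) ^ 2 := by
      rw [Real.sin_arcsin_of_sq_add_sq hxy]
      linear_combination p ^ 2 * hc u hu + hpc
    have hα : HasDerivAt (fun t => Real.arcsin (-w t)) _ u :=
      (Real.hasDerivAt_arcsin_of_sq_add_sq hxy hy0).comp (h := fun t => -w t) u (hw' u hu).neg
    refine ⟨_, (hasDerivAt_ellipticF_comp (α := fun t => Real.arcsin (-w t)) hp0 hp1 hd0
      hd' hα).const_mul p, ?_, ?_⟩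
    · beta_reduce
      rw [mul_div_cancel_left₀ _ hp0.ne', jacobiDn_ellipticF hp0 hp1 hd0 hd']
      field_simp
    · rw [(hasDerivAt_ellipticE_jacobiAm_div hp0 hp1 _ _).deriv, mul_div_cancel_left₀ _ hp0.ne',
        jacobiDn_ellipticF hp0 hp1 hd0 hd', ← hy]
      have h1 : 1 / p ^ 2 * (p * R u) ^ 2 - (1 - p ^ 2) / p ^ 2 = y ^ 2 := by
        rw [hy]
        field_simp
        linear_combination p ^ 2 * hc u hu + hpc
      rw [h1]
      field_simp

/-- The models have first integral `1 - p ^ 2`, `0` and `1 - 1 / p ^ 2`. They are singular where `sn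
= 0` (or `tanh = 0`); the condition `w ^ 2 < 1` keeps the curve off these points, so `arccos` and
`arcosh` are differentiable where used. -/
theorem exists_isPseudosphericalProfile_runsAlong {I : Set ℝ} {R w V : ℝ → ℝ} {c : ℝ}
    (hR : ∀ u ∈ I, 0 < R u)
    (hw : ∀ u ∈ I, w u ^ 2 < 1)
    (hw' : ∀ u ∈ I, HasDerivAt w (R u * V u) u)
    (hR' : ∀ u ∈ I, HasDerivAt R (w u * V u) u)
    (hc : ∀ u ∈ I, w u ^ 2 - R u ^ 2 = c) (hc1 : c < 1) :
    ∃ r h, IsPseudosphericalProfile r h ∧ RunsAlong I R w V r h := by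
  have hex : ∀ u ∈ I, ∃ y : ℝ, 0 < y ∧ y ^ 2 = 1 - w u ^ 2 := fun u hu =>
    ⟨Real.sqrt (1 - w u ^ 2), Real.sqrt_pos.2 (by linarith [hw u hu]),
      Real.sq_sqrt (by linarith [hw u hu])⟩
  rcases lt_trichotomy c 0 with hc0 | rfl | hc0
  · obtain ⟨p, hp0, hpc⟩ : ∃ p : ℝ, 0 < p ∧ p ^ 2 * (1 - c) = 1 := by
      have : 0 < 1 - c := by linarith
      refine ⟨Real.sqrt (1 / (1 - c)), Real.sqrt_pos.2 (by positivity), ?_⟩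
      rw [Real.sq_sqrt (by positivity)]
      field_simp
    have hp1 : p < 1 := by
      by_contra! hp
      nlinarith [mul_le_mul hp hp zero_le_one hp0.le]
    -- The choice `cn = w`, `sn > 0` runs through the model backwards, which is harmless since only
    -- the square of the height velocity is prescribed.
    refine ⟨_, _, Or.inr (Or.inr ⟨p, hp0, hp1, rfl, rfl⟩),
      contDiff_ellipticE_jacobiAm_div hp0 hp1 _,
      fun t => p * ellipticF p (Real.arccos (w t)), fun u hu => ?_⟩
    have hRu := hR u hu
    obtain ⟨y, hy0, hy⟩ := hex u hu
    have hxy : (w u) ^ 2 + y ^ 2 = 1 := by rw [hy]; ring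
    have hd0 : 0 < p * R u := by positivity
    have hd' : (p * R u) ^ 2 = 1 - p ^ 2 * Real.sin (Real.arccos (w u)) ^ 2 := by
      rw [Real.sin_arccos_of_sq_add_sq hxy hy0, hy]
      linear_combination -p ^ 2 * hc u hu + hpc
    have hα : HasDerivAt (fun t => Real.arccos (w t)) _ u :=
      (Real.hasDerivAt_arccos_of_sq_add_sq hxy hy0).comp u (hw' u hu)
    refine ⟨_, (hasDerivAt_ellipticF_comp (α := fun t => Real.arccos (w t)) hp0 hp1 hd0
      hd' hα).const_mul p, ?_, ?_⟩
    · beta_reduce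
      rw [mul_div_cancel_left₀ _ hp0.ne', jacobiDn_ellipticF hp0 hp1 hd0 hd']
      field_simp
    · rw [(hasDerivAt_ellipticE_jacobiAm_div hp0 hp1 _ _).deriv, mul_div_cancel_left₀ _ hp0.ne',
        jacobiDn_ellipticF hp0 hp1 hd0 hd', ← hy]
      have h1 : 1 / p ^ 2 * (p * R u) ^ 2 - 1 / p ^ 2 = -y ^ 2 := by
        rw [hy]
        field_simp
        linear_combination -p ^ 2 * hc u hu + hpc
      rw [h1]
      field_simp
  · refine ⟨_, _, Or.inr (Or.inl ⟨rfl, rfl⟩), Real.contDiff_tanh_infty.sub contDiff_id,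
      fun t => Real.arcosh (R t)⁻¹, fun u hu => ?_⟩
    have hRu := hR u hu
    obtain ⟨y, hy0, hy⟩ := hex u hu
    have hwR : w u ^ 2 = R u ^ 2 := by linarith [hc u hu]
    have hR1 : 1 < (R u)⁻¹ := (one_lt_inv₀ hRu).2 (by nlinarith [hw u hu])
    have hs : Real.sqrt ((R u)⁻¹ ^ 2 - 1) = y / R u := by
      rw [← Real.sqrt_sq (div_pos hy0 hRu).le]
      congr 1
      field_simp
      linear_combination -hy + hwR
    have hα : HasDerivAt (fun t => Real.arcosh (R t)⁻¹) _ u :=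
      (Real.hasDerivAt_arcosh hR1).comp (h := fun t => (R t)⁻¹) u ((hR' u hu).inv hRu.ne')
    refine ⟨_, hα, ?_, ?_⟩
    · beta_reduce
      rw [Real.cosh_arcosh hR1.le, one_div, inv_inv]
    · rw [((Real.hasDerivAt_tanh_inv_cosh_sq _).fun_sub (hasDerivAt_id' _)).deriv,
        Real.cosh_arcosh hR1.le, hs, one_div, inv_inv, ← hy]
      have h1 : R u ^ 2 - 1 = -y ^ 2 := by rw [hy]; linear_combination -hwR
      rw [h1]
      field_simp
      linear_combination V u ^ 2 * hwR
  · obtain ⟨p, hp0, hpc⟩ : ∃ p : ℝ, 0 < p ∧ p ^ 2 = 1 - c :=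
      ⟨Real.sqrt (1 - c), Real.sqrt_pos.2 (by linarith), Real.sq_sqrt (by linarith)⟩
    have hp1 : p < 1 := by nlinarith
    -- Here `cn = R / p` and `dn = |w|`. The sign of `w` only decides the direction of travel, so
    -- `φ` can be built from `R` alone.
    refine ⟨_, _, Or.inl ⟨p, hp0, hp1, rfl, rfl⟩,
      (contDiff_ellipticE_jacobiAm hp0 hp1).sub contDiff_id,
      fun t => ellipticF p (Real.arccos (R t / p)), fun u hu => ?_⟩
    have hRu := hR u hu
    obtain ⟨y, hy0, hy⟩ := hex u hu
    have hxy : (R u / p) ^ 2 + (y / p) ^ 2 = 1 := by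
      field_simp
      linear_combination -hc u hu - hpc + hy
    have hy' : 0 < y / p := by positivity
    have hw0 : w u ≠ 0 := by
      intro h0
      have := hc u hu
      rw [h0] at this
      nlinarith
    have hd0 : 0 < |w u| := abs_pos.2 hw0
    have hd' : |w u| ^ 2 = 1 - p ^ 2 * Real.sin (Real.arccos (R u / p)) ^ 2 := by
      rw [Real.sin_arccos_of_sq_add_sq hxy hy', sq_abs]
      field_simp
      linear_combination hy
    have hα : HasDerivAt (fun t => Real.arccos (R t / p)) _ u :=
      (Real.hasDerivAt_arccos_of_sq_add_sq hxy hy').comp (h := fun t => R t / p) u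
        ((hR' u hu).div_const p)
    refine ⟨_, hasDerivAt_ellipticF_comp hp0 hp1 hd0 hd' hα, ?_, ?_⟩
    · beta_reduce
      rw [jacobiCn, jacobiAm_ellipticF hp0 hp1, Real.cos_arccos_of_sq_add_sq hxy]
      field_simp
    · rw [((hasDerivAt_ellipticE_jacobiAm hp0 hp1 _).fun_sub (hasDerivAt_id' _)).deriv,
        jacobiDn_ellipticF hp0 hp1 hd0 hd', sq_abs, ← hy]
      have h1 : w u ^ 2 - 1 = -y ^ 2 := by rw [hy]; ring
      rw [h1]
      field_simp
      rw [sq_abs]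

/-! ### From matching velocities to a homothety -/

theorem ContDiffOn.hasDerivAt_of_isOpen {f : ℝ → ℝ} {I : Set ℝ} {n : WithTop ℕ∞}
    (hf : ContDiffOn ℝ n f I) (hn : 2 ≤ n) (hI : IsOpen I) {u : ℝ} (hu : u ∈ I) :
    HasDerivAt f (deriv f u) u ∧ HasDerivAt (deriv f) (deriv (deriv f) u) u := by
  have h2 : ContDiffOn ℝ (1 + 1) f I := hf.of_le (by rwa [one_add_one_eq_two])
  have h1 := (contDiffOn_succ_iff_deriv_of_isOpen hI).1 h2
  exact ⟨(h1.1.differentiableAt (hI.mem_nhds hu)).hasDerivAt,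
    ((h1.2.2.differentiableOn one_ne_zero).differentiableAt (hI.mem_nhds hu)).hasDerivAt⟩

/-- Regularity bootstrap for a solution of `g (φ) φ' = f'`. -/
theorem contDiffOn_of_hasDerivAt_div_comp {n : ℕ∞} {I : Set ℝ} {f g φ : ℝ → ℝ} (hI : IsOpen I)
    (hf : ContDiffOn ℝ n f I) (hg : ContDiff ℝ (⊤ : ℕ∞) g) (hg0 : ∀ u ∈ I, g (φ u) ≠ 0)
    (hφ : ∀ u ∈ I, HasDerivAt φ (deriv f u / g (φ u)) u) : ContDiffOn ℝ n φ I := by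
  -- Working with finite orders covers `n = ∞`: if `φ` is of class `C^m`, so is `f' / g (φ) = φ'`.
  refine contDiffOn_iff_forall_nat_le.2 fun m => ?_
  induction m with
  | zero =>
    intro _
    exact contDiffOn_zero.2 fun u hu => (hφ u hu).continuousAt.continuousWithinAt
  | succ m ih =>
    intro hm
    have hm' : ((m : ℕ∞) + 1) ≤ n := by exact_mod_cast hm
    have hfm : ContDiffOn ℝ ((m : WithTop ℕ∞) + 1) f I := hf.of_le (by exact_mod_cast hm')
    have h1 := ih (le_trans le_self_add hm')
    have h2 : ContDiffOn ℝ (m : WithTop ℕ∞) (fun u => g (φ u)) I :=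
      (hg.of_le (by exact_mod_cast le_top)).comp_contDiffOn h1
    rw [Nat.cast_add, Nat.cast_one]
    refine (contDiffOn_succ_iff_deriv_of_isOpen hI).2
      ⟨fun u hu => (hφ u hu).differentiableAt.differentiableWithinAt, by simp, ?_⟩
    exact (((contDiffOn_succ_iff_deriv_of_isOpen hI).1 hfm).2.2.div h2 hg0).congr
      fun u hu => (hφ u hu).deriv

theorem injOn_of_deriv_ne_zero {f : ℝ → ℝ} {I : Set ℝ} (hI : I.OrdConnected)
    (hf : ContinuousOn f I) (h : ∀ u ∈ I, deriv f u ≠ 0) : Set.InjOn f I := by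
  have key : ∀ a ∈ I, ∀ b ∈ I, a < b → f a ≠ f b := by
    intro a ha b hb hab hfab
    have hsub : Set.Icc a b ⊆ I := hI.out ha hb
    obtain ⟨c, hc, hc0⟩ := exists_deriv_eq_zero hab (hf.mono hsub) hfab
    exact h c (hsub (Set.Ioo_subset_Icc_self hc)) hc0
  intro a ha b hb hab
  rcases lt_trichotomy a b with hlt | rfl | hlt
  · exact absurd hab (key a ha b hb hlt)
  · rfl
  · exact absurd hab.symm (key b hb a ha hlt)

/-- The isometry that scales heights by a sign and then translates vertically. -/
theorem exists_isometry_vertical {σ : ℝ} (hσ : σ = 1 ∨ σ = -1) (b : ℝ) :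
    ∃ T : E3 ≃ᵃⁱ[ℝ] E3, ∀ x y z : ℝ, T !₂[x, y, z] = !₂[x, y, σ * z + b] := by
  let e : Fin 3 → (ℝ ≃ₗᵢ[ℝ] ℝ) := fun i =>
    if i = 2 ∧ σ = -1 then LinearIsometryEquiv.neg ℝ else LinearIsometryEquiv.refl ℝ ℝ
  let S : E3 ≃ₗᵢ[ℝ] E3 := LinearIsometryEquiv.piLpCongrRight 2 e
  refine ⟨S.toAffineIsometryEquiv.trans (AffineIsometryEquiv.constVAdd ℝ E3 !₂[0, 0, b]),
    fun x y z => ?_⟩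
  ext i
  fin_cases i
  · simp [S, e, LinearIsometryEquiv.piLpCongrRight_apply]
  · simp [S, e, LinearIsometryEquiv.piLpCongrRight_apply]
  · rcases hσ with rfl | rfl
    · have : ¬ (1 : ℝ) = -1 := by norm_num
      simp [S, e, this, add_comm]
    · simp [S, e, LinearIsometryEquiv.piLpCongrRight_apply, add_comm]

/-- By Darboux's theorem a nowhere vanishing derivative has constant sign on an interval, so
continuity of `f'` and `g'` is not needed. -/
theorem exists_sign_eq_mul_of_sq_eq {I : Set ℝ} (hI : Convex ℝ I) {f g f' g' : ℝ → ℝ}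
    (hf : ∀ u ∈ I, HasDerivAt f (f' u) u) (hg : ∀ u ∈ I, HasDerivAt g (g' u) u)
    (hg0 : ∀ u ∈ I, g' u ≠ 0) (hsq : ∀ u ∈ I, f' u ^ 2 = g' u ^ 2) :
    ∃ σ : ℝ, (σ = 1 ∨ σ = -1) ∧ ∀ u ∈ I, f' u = σ * g' u := by
  have hf0 : ∀ u ∈ I, f' u ≠ 0 := fun u hu h0 => by
    have := hsq u hu
    rw [h0] at this
    exact hg0 u hu (pow_eq_zero_iff two_ne_zero |>.1 (by linarith))
  have h1 := hasDerivWithinAt_forall_lt_or_forall_gt_of_forall_ne hI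
    (fun u hu => (hf u hu).hasDerivWithinAt) hf0
  have h2 := hasDerivWithinAt_forall_lt_or_forall_gt_of_forall_ne hI
    (fun u hu => (hg u hu).hasDerivWithinAt) hg0
  have h3 : ∀ u ∈ I, f' u = g' u ∨ f' u = -g' u := fun u hu => sq_eq_sq_iff_eq_or_eq_neg.1 (hsq u hu)
  rcases h1 with h1 | h1 <;> rcases h2 with h2 | h2
  · refine ⟨1, Or.inl rfl, fun u hu => ?_⟩
    rcases h3 u hu with h | h <;> linarith [h1 u hu, h2 u hu]
  · refine ⟨-1, Or.inr rfl, fun u hu => ?_⟩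
    rcases h3 u hu with h | h <;> linarith [h1 u hu, h2 u hu]
  · refine ⟨-1, Or.inr rfl, fun u hu => ?_⟩
    rcases h3 u hu with h | h <;> linarith [h1 u hu, h2 u hu]
  · refine ⟨1, Or.inl rfl, fun u hu => ?_⟩
    rcases h3 u hu with h | h <;> linarith [h1 u hu, h2 u hu]

/-- A profile curve that runs along `(r, h)` after scaling by `k` generates a surface homothetic to
the one generated by `(r, h)`. -/
theorem RunsAlong.isHomotheticTo {n : ℕ∞} {I : Set ℝ} (hI : IsOpen I) (hIc : IsConnected I)
    {ρ η R w V r h : ℝ → ℝ} {k : ℝ} (hk : 0 < k) (H : RunsAlong I R w V r h)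
    (hR : ∀ u ∈ I, R u = k * ρ u) (hη : ContDiffOn ℝ n η I) (hn : 2 ≤ n)
    (hη0 : ∀ u ∈ I, deriv η u ≠ 0)
    (hV : ∀ u ∈ I, (1 - w u ^ 2) * V u ^ 2 = (k * deriv η u) ^ 2)
    {X : ℝ → ℝ → E3} {A : E3 ≃ᵃⁱ[ℝ] E3} (hX : ∀ u ∈ I, ∀ θ : ℝ, X u θ = A (revolve ρ η u θ)) :
    IsHomotheticTo n (1 / k) X I (revolve r h) := by
  obtain ⟨hh, φ, hφ⟩ := H
  choose! d hd hr hsq using hφ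
  have hord : I.OrdConnected := hIc.isPreconnected.ordConnected
  have hη1 : ∀ u ∈ I, HasDerivAt (fun t => k * η t) (k * deriv η u) u := fun u hu =>
    (hη.hasDerivAt_of_isOpen (WithTop.coe_le_coe.2 hn) hI hu).1.const_mul k
  have hcomp : ∀ u ∈ I, HasDerivAt (fun t => h (φ t)) (deriv h (φ u) * d u) u := fun u hu =>
    ((hh.differentiable (by simp)).differentiableAt.hasDerivAt).comp u (hd u hu)
  have hk0 : ∀ u ∈ I, k * deriv η u ≠ 0 := fun u hu => mul_ne_zero hk.ne' (hη0 u hu)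
  obtain ⟨σ, hσ, hσe⟩ := exists_sign_eq_mul_of_sq_eq hord.convex hcomp hη1 hk0
    fun u hu => (hsq u hu).trans (hV u hu)
  have hσ2 : σ * σ = 1 := by rcases hσ with rfl | rfl <;> norm_num
  have hσ0 : σ ≠ 0 := left_ne_zero_of_mul_eq_one hσ2
  have hne : ∀ u ∈ I, deriv h (φ u) * d u ≠ 0 := fun u hu => by
    rw [hσe u hu]; exact mul_ne_zero hσ0 (hk0 u hu)
  have hd0 : ∀ u ∈ I, deriv φ u ≠ 0 := fun u hu => by
    rw [(hd u hu).deriv]; exact right_ne_zero_of_mul (hne u hu)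
  have hdiff : ∀ u ∈ I, HasDerivAt (fun t => h (φ t) - σ * (k * η t)) 0 u := fun u hu =>
    ((hcomp u hu).fun_sub ((hη1 u hu).const_mul σ)).congr_deriv (by rw [hσe u hu, sub_self])
  obtain ⟨b, hb⟩ := hI.exists_is_const_of_deriv_eq_zero hIc.isPreconnected
    (fun u hu => (hdiff u hu).differentiableAt.differentiableWithinAt)
    (fun u hu => (hdiff u hu).deriv)
  -- Solving `h (φ) - σ k η = b` for `η`, with `σ ^ 2 = 1`, gives this translation.
  obtain ⟨T, hT⟩ := exists_isometry_vertical hσ (-(σ * b / k))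
  have hsmooth : ContDiffOn ℝ n φ I := by
    refine contDiffOn_of_hasDerivAt_div_comp (f := fun u => σ * (k * η u)) hI
      (contDiffOn_const.mul (contDiffOn_const.mul hη)) (contDiff_infty_iff_deriv.1 hh).2
      (fun u hu => left_ne_zero_of_mul (hne u hu)) fun u hu => ?_
    rw [((hη1 u hu).const_mul σ).deriv, ← hσe u hu,
      mul_div_cancel_left₀ _ (left_ne_zero_of_mul (hne u hu))]
    exact hd u hu
  refine ⟨T.trans A, φ, hsmooth, hd0, injOn_of_deriv_ne_zero hord hsmooth.continuousOn hd0,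
    fun u hu θ => ?_⟩
  rw [hX u hu, AffineIsometryEquiv.coe_trans, Function.comp_apply]
  congr 1
  have e1 : (1 / k) • revolve r h (φ u) θ =
      !₂[ρ u * Real.cos θ, ρ u * Real.sin θ, h (φ u) / k] := by
    have hrk : r (φ u) = k * ρ u := by rw [← hr u hu, hR u hu]
    ext i
    fin_cases i
    · simp [revolve, hrk]; field_simp
    · simp [revolve, hrk]; field_simp
    · simp [revolve]; field_simp
  have e2 : σ * (h (φ u) / k) + -(σ * b / k) = η u := by
    have := hb u hu
    field_simp
    linear_combination σ * this + (k * η u) * hσ2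
  rw [e1, hT, e2]
  rfl

/-! ### The first integral and the classification -/

/-- The cosine `ρ' / v` of the slope angle of a profile curve of curvature `K` satisfies
`(ρ' / v)' = -K ρ v`. -/
theorem hasDerivAt_cos_slope {ρ1 η1 : ℝ → ℝ} {ρ0 ρ2 η2 K u : ℝ} (h1 : HasDerivAt ρ1 ρ2 u)
    (h2 : HasDerivAt η1 η2 u) (hv : 0 < ρ1 u ^ 2 + η1 u ^ 2)
    (hK : K * (ρ0 * (ρ1 u ^ 2 + η1 u ^ 2) ^ 2) = η1 u * (η2 * ρ1 u - η1 u * ρ2)) :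
    HasDerivAt (fun t => ρ1 t / Real.sqrt (ρ1 t ^ 2 + η1 t ^ 2))
      (-(K * ρ0 * Real.sqrt (ρ1 u ^ 2 + η1 u ^ 2))) u := by
  have h := h1.fun_div (((h1.fun_pow 2).fun_add (h2.fun_pow 2)).sqrt hv.ne') (Real.sqrt_pos.2 hv).ne'
  refine h.congr_deriv ?_
  have hs := Real.sq_sqrt hv.le
  have hs0 := Real.sqrt_pos.2 hv
  rw [← hs] at hK
  generalize Real.sqrt (ρ1 u ^ 2 + η1 u ^ 2) = v at *
  field_simp
  norm_num
  grind

theorem exists_profile_isHomotheticTo {n : ℕ∞} (hn : 2 ≤ n) {I : Set ℝ} (hI : IsOpen I)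
    (hIc : IsConnected I) {X : ℝ → ℝ → E3} (hX : IsSurfaceOfRevolution n X I) {K : ℝ} (hK : K ≠ 0)
    (hc : ∀ u ∈ I, ∀ θ : ℝ, gaussCurvature X u θ = K) :
    ∃ r h : ℝ → ℝ,
      ((0 < K ∧ IsSphericalProfile r h) ∨ (K < 0 ∧ IsPseudosphericalProfile r h)) ∧
      IsHomotheticTo n (1 / Real.sqrt |K|) X I (revolve r h) := by
  obtain ⟨A, ρ, η, hρ, hη, hρ0, hreg, hXA⟩ := hX
  have hn' : (2 : WithTop ℕ∞) ≤ n := WithTop.coe_le_coe.2 hn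
  have hρ' := fun u (hu : u ∈ I) => hρ.hasDerivAt_of_isOpen hn' hI hu
  have hη' := fun u (hu : u ∈ I) => hη.hasDerivAt_of_isOpen hn' hI hu
  have hv : ∀ u ∈ I, 0 < deriv ρ u ^ 2 + deriv η u ^ 2 := fun u hu => by
    rcases hreg u hu with h | h <;> positivity
  have hcurv : ∀ u ∈ I, K * (ρ u * (deriv ρ u ^ 2 + deriv η u ^ 2) ^ 2) =
      deriv η u * (deriv (deriv η) u * deriv ρ u - deriv η u * deriv (deriv ρ) u) := fun u hu => by
    have h1 := gaussCurvature_revolve hI (fun t ht => (hρ' t ht).1) (fun t ht => (hη' t ht).1) hu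
      (hρ' u hu).2 (hη' u hu).2 0 (hρ0 u hu).ne' (hv u hu).ne'
    rw [← gaussCurvature_isometry_comp A hI hXA hu, hc u hu] at h1
    rw [h1]
    exact div_mul_cancel₀ _ (mul_pos (hρ0 u hu) (pow_pos (hv u hu) 2)).ne'
  -- The curvature numerator has `η'` as a factor, so a horizontal tangent would force `K = 0`.
  have hη0 : ∀ u ∈ I, deriv η u ≠ 0 := fun u hu h0 => by
    have h1 := hcurv u hu
    rw [h0, zero_mul] at h1
    refine mul_ne_zero hK (mul_pos (hρ0 u hu) (pow_pos (hv u hu) 2)).ne' ?_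
    simpa [h0] using h1
  set v : ℝ → ℝ := fun t => Real.sqrt (deriv ρ t ^ 2 + deriv η t ^ 2) with hvdef
  have hv0 : ∀ u ∈ I, 0 < v u := fun u hu => Real.sqrt_pos.2 (hv u hu)
  have hv2 : ∀ u ∈ I, v u ^ 2 = deriv ρ u ^ 2 + deriv η u ^ 2 := fun u hu =>
    Real.sq_sqrt (hv u hu).le
  set w : ℝ → ℝ := fun t => deriv ρ t / v t with hwdef
  have hw' : ∀ u ∈ I, HasDerivAt w (-(K * ρ u * v u)) u := fun u hu =>
    hasDerivAt_cos_slope (hρ' u hu).2 (hη' u hu).2 (hv u hu) (hcurv u hu)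
  have hwv : ∀ u ∈ I, w u * v u = deriv ρ u := fun u hu => div_mul_cancel₀ _ (hv0 u hu).ne'
  have hwη : ∀ u ∈ I, (1 - w u ^ 2) * v u ^ 2 = deriv η u ^ 2 := fun u hu => by
    linear_combination hv2 u hu - (w u * v u + deriv ρ u) * hwv u hu
  have hw1 : ∀ u ∈ I, w u ^ 2 < 1 := fun u hu => by
    have h1 : 0 < (1 - w u ^ 2) * v u ^ 2 := by
      rw [hwη u hu]; exact sq_pos_of_ne_zero (hη0 u hu)
    linarith [pos_of_mul_pos_left h1 (sq_nonneg (v u))]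
  -- The first integral: `2 w w' = -2 K ρ w v` cancels `2 K ρ ρ'`.
  have hconst : ∀ u ∈ I, HasDerivAt (fun t => w t ^ 2 + K * ρ t ^ 2) 0 u := fun u hu => by
    refine (((hw' u hu).fun_pow 2).fun_add
      (((hρ' u hu).1.fun_pow 2).const_mul K)).congr_deriv ?_
    rw [← hwv u hu]
    norm_num
    ring
  obtain ⟨c, hcc⟩ := hI.exists_is_const_of_deriv_eq_zero hIc.isPreconnected
    (fun u hu => (hconst u hu).differentiableAt.differentiableWithinAt)
    (fun u hu => (hconst u hu).deriv)
  obtain ⟨u₀, hu₀⟩ := hIc.nonempty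
  set k := Real.sqrt |K| with hkdef
  have hk : 0 < k := Real.sqrt_pos.2 (abs_pos.2 hK)
  have hk2 : k ^ 2 = |K| := Real.sq_sqrt (abs_nonneg K)
  have hR : ∀ u ∈ I, 0 < k * ρ u := fun u hu => mul_pos hk (hρ0 u hu)
  have hR' : ∀ u ∈ I, HasDerivAt (fun t => k * ρ t) (w u * (k * v u)) u := fun u hu =>
    ((hρ' u hu).1.const_mul k).congr_deriv (by rw [← hwv u hu]; ring)
  have hV : ∀ u ∈ I, (1 - w u ^ 2) * (k * v u) ^ 2 = (k * deriv η u) ^ 2 := fun u hu => by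
    linear_combination k ^ 2 * hwη u hu
  rcases hK.lt_or_gt with hneg | hpos
  · rw [abs_of_neg hneg] at hk2
    obtain ⟨r, h, hrh, hrun⟩ := exists_isPseudosphericalProfile_runsAlong
      (R := fun t => k * ρ t) (w := w) (V := fun t => k * v t) (c := c) hR hw1
      (fun u hu => (hw' u hu).congr_deriv (by linear_combination (-(ρ u * v u)) * hk2)) hR'
      (fun u hu => by linear_combination hcc u hu - ρ u ^ 2 * hk2)
      -- For `K < 0`, `c ≤ w ^ 2 < 1` at `u₀`.
      (by nlinarith [hcc u₀ hu₀, hw1 u₀ hu₀, mul_nonneg (neg_nonneg.2 hneg.le) (sq_nonneg (ρ u₀))])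
    exact ⟨r, h, Or.inr ⟨hneg, hrh⟩,
      hrun.isHomotheticTo hI hIc hk (fun _ _ => rfl) hη hn hη0 hV hXA⟩
  · rw [abs_of_pos hpos] at hk2
    obtain ⟨r, h, hrh, hrun⟩ := exists_isSphericalProfile_runsAlong
      (R := fun t => k * ρ t) (w := w) (V := fun t => k * v t) (c := c) hR hw1
      (fun u hu => (hw' u hu).congr_deriv (by linear_combination (ρ u * v u) * hk2)) hR'
      (fun u hu => by linear_combination hcc u hu + ρ u ^ 2 * hk2)
      -- For `K > 0`, `c ≥ K ρ ^ 2 > 0` at `u₀`.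
      (by nlinarith [hcc u₀ hu₀, sq_nonneg (w u₀), mul_pos hpos (pow_pos (hρ0 u₀ hu₀) 2)])
    exact ⟨r, h, Or.inl ⟨hpos, hrh⟩,
      hrun.isHomotheticTo hI hIc hk (fun _ _ => rfl) hη hn hη0 hV hXA⟩

/-- Classification of the surfaces of revolution with constant Gauss curvature `K ≠ 0`; the last
two clauses say that the listed surfaces have Gauss curvature `+1` and `-1`, as labelled. -/
theorem mainTheorem2 :
    (∀ (n : ℕ∞), 2 ≤ n →
      ∀ (I : Set ℝ), IsOpen I → IsConnected I →
      ∀ (X : ℝ → ℝ → E3), IsSurfaceOfRevolution n X I →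
      ∀ (K : ℝ), K ≠ 0 → (∀ u ∈ I, ∀ θ : ℝ, gaussCurvature X u θ = K) →
        ∃ r h : ℝ → ℝ,
          ((0 < K ∧ IsSphericalProfile r h) ∨ (K < 0 ∧ IsPseudosphericalProfile r h)) ∧
          IsHomotheticTo n (1 / Real.sqrt |K|) X I (revolve r h)) ∧
    (∀ r h : ℝ → ℝ, IsSphericalProfile r h →
      ∀ s θ : ℝ, IsImmersedAt (revolve r h) s θ → gaussCurvature (revolve r h) s θ = 1) ∧
    (∀ r h : ℝ → ℝ, IsPseudosphericalProfile r h →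
      ∀ s θ : ℝ, IsImmersedAt (revolve r h) s θ → gaussCurvature (revolve r h) s θ = -1) := by
  exact ⟨fun _ hn _ hI hIc _ hX _ hK hc => exists_profile_isHomotheticTo hn hI hIc hX hK hc,
    fun _ _ H => H.gaussCurvature_eq, fun _ _ H => H.gaussCurvature_eq⟩
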